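/- The sentences of continuous logic in the language of C$^*$-algebras are built as follows. Atomic formulas are norms $\|P(x_1,\dots,x_n)\|$ of $*$-polynomials $P$ (without constant term, with complex coefficients) in noncommuting variables; finitely many formulas may be combined by any continuous function $\mathbb{R}^k\to\mathbb{R}$; and one may take $\sup_{\|x\|\le 1}$ or $\inf_{\|x\|\le 1}$ of a formula over a variable $x$ ranging over the closed unit ball. A sentence is a formula $\varphi$ without free variables; its value in a C$^*$-algebra $\mathcal{A}$ is a real number $\varphi^{\mathcal{A}}$. A C$^*$-algebra $\mathcal{A}$ is called pseudomatricial if $\varphi^{\mathcal{A}}=0$ for every sentence $\varphi$ such that $\varphi^{M_n(\mathbb{C})}=0$ for all $n\ge 1$. A projection $p=p^*=p^2$ in $\mathcal{A}$ is minimal if $p\neq 0$ and the only projections $q\le p$ are $0$ and $p$. A tracial state on $\mathcal{A}$ is a positive linear functional $\tau$ of norm one with $\tau(ab)=\tau(ba)$ for all $a,b\in\mathcal{A}$; it is faithful if $\tau(a^*a)=0$ implies $a=0$. A C$^*$-algebra is simple if it is nonzero and its only closed two-sided ideals are $\{0\}$ and itself. Corollary 6.4. Let $\mathcal{A}$ be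 an infinite-dimensional pseudomatricial C$^*$-algebra. Then: (1) $\tau(p)=0$ for every minimal projection $p$ in $\mathcal{A}$ and every tracial state $\tau$ on $\mathcal{A}$; (2) there exists a tracial state on $\mathcal{A}$ which is not faithful; (3) $\mathcal{A}$ is not simple. -/

import Mathlib

noncomputable section

namespace CStarLogic

/-- Terms of the language of C*-algebras in the variables `x₀, …, x_{n-1}`: the expressions built
from the variables and the constant `0` by addition, multiplication, multiplication by complex
scalars and the adjoint, that is, the `*`-polynomials (without constant term). -/
inductive CTerm (n : ℕ) : Type
  | var (i : Fin n) : CTerm n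
  | zero : CTerm n
  | add (s t : CTerm n) : CTerm n
  | mul (s t : CTerm n) : CTerm n
  | smul (c : ℂ) (t : CTerm n) : CTerm n
  | star (t : CTerm n) : CTerm n

/-- Formulas of continuous logic in the language of C*-algebras, with free variables among
`x₀, …, x_{n-1}`. Atomic formulas are norms of terms, the connectives are all continuous functions
`ℝ^k → ℝ`, and the quantifiers are the supremum and the infimum over the closed unit ball. The
quantifiers bind the variable `x₀` and shift the other variables down by one. -/
inductive CFormula : ℕ → Type
  | norm {n : ℕ} (t : CTerm n) : CFormula n
  | conn {n k : ℕ} (u : (Fin k → ℝ) → ℝ) (hu : Continuous u) (φ : Fin k → CFormula n) : CFormula n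
  | sup {n : ℕ} (φ : CFormula (n + 1)) : CFormula n
  | inf {n : ℕ} (φ : CFormula (n + 1)) : CFormula n

/-- A sentence is a formula without free variables. -/
abbrev CSentence : Type := CFormula 0

universe u

/-- The value in `A` of a term at the assignment `v` of its variables. -/
def CTerm.eval {A : Type u} [NonUnitalCStarAlgebra A] {n : ℕ} (v : Fin n → A) : CTerm n → A
  | .var i => v i
  | .zero => 0
  | .add s t => s.eval v + t.eval v
  | .mul s t => s.eval v * t.eval v
  | .smul c t => c • t.eval v
  | .star t => Star.star (t.eval v)

/-- The value in `A` of a formula at the assignment `v` of its free variables. The suprema and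
infima are over a nonempty set, and over bounded sets of reals by `CFormula.exists_bound`. -/
def CFormula.eval (A : Type u) [NonUnitalCStarAlgebra A] :
    {n : ℕ} → CFormula n → (Fin n → A) → ℝ
  | _, .norm t, v => ‖t.eval v‖
  | _, .conn u _ φ, v => u fun i => CFormula.eval A (φ i) v
  | _, .sup φ, v => ⨆ x : Metric.closedBall (0 : A) 1,
      CFormula.eval A φ (Fin.cons (α := fun _ => A) (x : A) v)
  | _, .inf φ, v => ⨅ x : Metric.closedBall (0 : A) 1,
      CFormula.eval A φ (Fin.cons (α := fun _ => A) (x : A) v)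

/-- The value `φ^A` of a sentence `φ` in the C*-algebra `A`. -/
def CSentence.value (A : Type u) [NonUnitalCStarAlgebra A] (φ : CSentence) : ℝ :=
  CFormula.eval A φ Fin.elim0

theorem CTerm.exists_bound (A : Type u) [NonUnitalCStarAlgebra A] {n : ℕ} (t : CTerm n) (r : ℝ) :
    ∃ C : ℝ, ∀ v : Fin n → A, (∀ i, ‖v i‖ ≤ r) → ‖t.eval v‖ ≤ C := by
  induction t with
  | var i => exact ⟨r, fun v hv => hv i⟩
  | zero => exact ⟨0, fun v _ => by simp [CTerm.eval]⟩
  | add s t hs ht =>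
    obtain ⟨C, hC⟩ := hs
    obtain ⟨D, hD⟩ := ht
    exact ⟨C + D, fun v hv => (norm_add_le _ _).trans (add_le_add (hC v hv) (hD v hv))⟩
  | mul s t hs ht =>
    obtain ⟨C, hC⟩ := hs
    obtain ⟨D, hD⟩ := ht
    exact ⟨C * D, fun v hv => (norm_mul_le _ _).trans
      (mul_le_mul (hC v hv) (hD v hv) (norm_nonneg _) ((norm_nonneg _).trans (hC v hv)))⟩
  | smul c t ht =>
    obtain ⟨C, hC⟩ := ht
    exact ⟨‖c‖ * C, fun v hv => (norm_smul_le _ _).trans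
      (mul_le_mul_of_nonneg_left (hC v hv) (norm_nonneg _))⟩
  | star t ht =>
    obtain ⟨C, hC⟩ := ht
    exact ⟨C, fun v hv => by simpa [CTerm.eval] using hC v hv⟩

/-- A formula is bounded on bounded sets of assignments, so that the suprema and infima in the
evaluation of a formula are genuine. -/
theorem CFormula.exists_bound (A : Type u) [NonUnitalCStarAlgebra A] {n : ℕ} (φ : CFormula n)
    (r : ℝ) : ∃ C : ℝ, ∀ v : Fin n → A, (∀ i, ‖v i‖ ≤ r) → |φ.eval A v| ≤ C := by
  have key : ∀ {m : ℕ} {r : ℝ} (v : Fin m → A), (∀ i, ‖v i‖ ≤ r) → ∀ x : Metric.closedBall (0 : A) 1,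
      ∀ i, ‖(Fin.cons (α := fun _ => A) (x : A) v : Fin (m + 1) → A) i‖ ≤ max r 1 := by
    intro m r v hv x i
    refine Fin.cases ?_ (fun j => ?_) i
    · simpa using Or.inr (mem_closedBall_zero_iff.1 x.2)
    · simpa using Or.inl (hv j)
  have : Nonempty (Metric.closedBall (0 : A) 1) := ⟨⟨0, by simp⟩⟩
  induction φ generalizing r with
  | norm t =>
    obtain ⟨C, hC⟩ := t.exists_bound A r
    exact ⟨C, fun v hv => by simpa [CFormula.eval] using hC v hv⟩
  | conn u hu φ ih =>
    choose C hC using fun i => ih i r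
    obtain ⟨D, hD⟩ := (isCompact_univ_pi fun i => isCompact_Icc (a := -C i)
      (b := C i)).exists_bound_of_continuousOn hu.continuousOn
    exact ⟨D, fun v hv => hD _ fun i _ => abs_le.1 (hC i v hv)⟩
  | sup φ ih =>
    obtain ⟨C, hC⟩ := ih (max r 1)
    refine ⟨C, fun v hv => abs_le.2 ⟨?_, ?_⟩⟩
    · exact (abs_le.1 (hC _ (key v hv ⟨0, by simp⟩))).1.trans
        (le_ciSup (f := fun x : Metric.closedBall (0 : A) 1 =>
            φ.eval A (Fin.cons (α := fun _ => A) (x : A) v))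
          ⟨C, by rintro _ ⟨x, rfl⟩; exact (abs_le.1 (hC _ (key v hv x))).2⟩ ⟨0, by simp⟩)
    · exact ciSup_le fun x => (abs_le.1 (hC _ (key v hv x))).2
  | inf φ ih =>
    obtain ⟨C, hC⟩ := ih (max r 1)
    refine ⟨C, fun v hv => abs_le.2 ⟨?_, ?_⟩⟩
    · exact le_ciInf fun x => (abs_le.1 (hC _ (key v hv x))).1
    · exact (ciInf_le (f := fun x : Metric.closedBall (0 : A) 1 =>
            φ.eval A (Fin.cons (α := fun _ => A) (x : A) v))
          ⟨-C, by rintro _ ⟨x, rfl⟩; exact (abs_le.1 (hC _ (key v hv x))).1⟩ ⟨0, by simp⟩).trans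
        (abs_le.1 (hC _ (key v hv ⟨0, by simp⟩))).2

open scoped Matrix.Norms.L2Operator in
/-- A C*-algebra `A` is pseudomatricial if every sentence which evaluates to zero in all the matrix
algebras `M_n(ℂ)`, `n ≥ 1` (with the operator norm), evaluates to zero in `A`. -/
def IsPseudomatricial (A : Type u) [NonUnitalCStarAlgebra A] : Prop :=
  ∀ φ : CSentence,
    (∀ n : ℕ, 1 ≤ n → CSentence.value (Matrix (Fin n) (Fin n) ℂ) φ = 0) →
      CSentence.value A φ = 0

/-- A minimal projection: a nonzero projection `p` whose only subprojections (projections `q` with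
`q p = q`, that is, `q ≤ p`) are `0` and `p`. -/
structure IsMinimalProjection {A : Type u} [NonUnitalCStarAlgebra A] (p : A) : Prop where
  isStarProjection : IsStarProjection p
  ne_zero : p ≠ 0
  eq_zero_or_eq : ∀ q : A, IsStarProjection q → q * p = q → q = 0 ∨ q = p

open scoped ComplexOrder in
/-- A tracial state: a positive linear functional of norm one with `τ(ab) = τ(ba)`. -/
structure IsTracialState {A : Type u} [NonUnitalCStarAlgebra A] (τ : A →L[ℂ] ℂ) : Prop where
  nonneg : ∀ a : A, 0 ≤ τ (star a * a)
  norm_eq_one : ‖τ‖ = 1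
  mul_comm : ∀ a b : A, τ (a * b) = τ (b * a)

/-- A positive functional is faithful if it vanishes at no nonzero positive element `a* a`. -/
def IsFaithful {A : Type u} [NonUnitalCStarAlgebra A] (τ : A →L[ℂ] ℂ) : Prop :=
  ∀ a : A, τ (star a * a) = 0 → a = 0

/-- A closed two-sided ideal of a C*-algebra. -/
structure IsClosedIdeal {A : Type u} [NonUnitalCStarAlgebra A] (J : Submodule ℂ A) : Prop where
  isClosed : IsClosed (J : Set A)
  mul_mem_left : ∀ a : A, ∀ x ∈ J, a * x ∈ J
  mul_mem_right : ∀ a : A, ∀ x ∈ J, x * a ∈ J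

/-- A C*-algebra is simple if it is nonzero and has no closed two-sided ideals besides zero and
itself. -/
structure IsSimple (A : Type u) [NonUnitalCStarAlgebra A] : Prop where
  nontrivial : Nontrivial A
  eq_bot_or_eq_top : ∀ J : Submodule ℂ A, IsClosedIdeal J → J = ⊥ ∨ J = ⊤

end CStarLogic

end

/-! Every fact about matrices that is needed is written as a condition ∃ z ∀ x ∃ y, u ≤ 0 over unit
balls; `IsPseudomatricial.transfer` turns it into its approximate version in A, and stability of the
relations restores exact statements. A thus inherits a unit, a tracial state (the identity of M_n
has distance at least one from the span of the commutators; then Hahn–Banach), and a minimal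
projection (compressions by a rank-one projection are scalar, so their norms multiply).

The heart is that traces vanish at minimal projections. In M_n with n ≥ K, a projection without
proper nonzero subprojections is the initial projection of K partial isometries whose range
projections are orthogonal (`exists_subprojection_or_copies`). The sentence must also hold when n <
K, so its defect is multiplied by a factor measuring how far apart m points of the ball lie. For
suitable m this factor vanishes for n < K by compactness, while Riesz's lemma keeps it bounded below
in an infinite-dimensional A. Hence K |τ(p)| ≤ 3 for all K
(`IsPseudomatricial.apply_isMinimalProjection_eq_zero`).

A minimal projection then shows that the trace is not faithful, and the null space of the trace is a
proper nonzero closed ideal. -/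

noncomputable section

namespace CStarLogic

universe u

/-! ### Blocks of quantifiers -/

section Semantics

variable {A : Type u}

/-- The assignment which extends `v` by the values `y` of the `b` innermost variables. -/
def extend {c b : ℕ} (v : Fin c → A) (y : Fin b → A) (i : Fin (c + b)) : A :=
  if h : i.1 < b then y ⟨i, h⟩ else v ⟨i - b, by omega⟩

/-- The innermost variables of a block. -/
def innerVar (c : ℕ) {b : ℕ} (j : Fin b) : Fin (c + b) := ⟨j, by omega⟩

/-- The variables outside of the innermost block. -/
def outerVar {c : ℕ} (b : ℕ) (i : Fin c) : Fin (c + b) := ⟨b + i, by omega⟩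

theorem extend_innerVar {c b : ℕ} (v : Fin c → A) (y : Fin b → A) (j : Fin b) :
    extend v y (innerVar c j) = y j := by
  simp [extend, innerVar]

theorem extend_outerVar {c b : ℕ} (v : Fin c → A) (y : Fin b → A) (i : Fin c) :
    extend v y (outerVar b i) = v i := by
  simp [extend, outerVar]

theorem cons_extend {c b : ℕ} (v : Fin c → A) (y : Fin b → A) (x : A) :
    (Fin.cons (α := fun _ => A) x (extend v y) : Fin (c + b + 1) → A) =
      extend (b := b + 1) v (Fin.cons (α := fun _ => A) x y) := by
  funext i
  refine Fin.cases ?_ (fun j => ?_) i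
  · simp only [extend, Fin.cons_zero]
    rw [dif_pos (by simp)]
    rfl
  · simp only [extend, Fin.cons_succ]
    by_cases h : j.1 < b
    · rw [dif_pos h, dif_pos (by simpa using h)]
      rfl
    · rw [dif_neg h, dif_neg (by simpa using h)]
      congr 2
      simp

theorem extend_zero {c : ℕ} (v : Fin c → A) (y : Fin 0 → A) : extend v y = v := by
  funext i
  simp [extend]

variable [NonUnitalCStarAlgebra A]

/-- The supremum of a formula over its `b` innermost variables. -/
def iterSup {c : ℕ} : (b : ℕ) → CFormula (c + b) → CFormula c
  | 0, φ => φ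
  | b + 1, φ => iterSup b (CFormula.sup φ)

/-- The infimum of a formula over its `b` innermost variables. -/
def iterInf {c : ℕ} : (b : ℕ) → CFormula (c + b) → CFormula c
  | 0, φ => φ
  | b + 1, φ => iterInf b (CFormula.inf φ)

theorem exists_bound_cons {n : ℕ} (φ : CFormula (n + 1)) (v : Fin n → A) :
    ∃ C : ℝ, ∀ x : Metric.closedBall (0 : A) 1,
      |φ.eval A (Fin.cons (α := fun _ => A) (x : A) v)| ≤ C := by
  obtain ⟨C, hC⟩ := φ.exists_bound A (max 1 ‖v‖)
  refine ⟨C, fun x => hC _ fun i => ?_⟩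
  refine Fin.cases ?_ (fun j => ?_) i
  · simpa using Or.inl (mem_closedBall_zero_iff.1 x.2)
  · simpa using Or.inr (norm_le_pi_norm v j)

theorem eval_sup_le_iff {n : ℕ} (φ : CFormula (n + 1)) (v : Fin n → A) (r : ℝ) :
    (CFormula.sup φ).eval A v ≤ r ↔
      ∀ x : A, ‖x‖ ≤ 1 → φ.eval A (Fin.cons (α := fun _ => A) x v) ≤ r := by
  have : Nonempty (Metric.closedBall (0 : A) 1) := ⟨⟨0, by simp⟩⟩
  obtain ⟨C, hC⟩ := exists_bound_cons φ v
  refine ⟨fun h x hx => ?_, fun h => ciSup_le fun x => h x (mem_closedBall_zero_iff.1 x.2)⟩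
  exact (le_ciSup (f := fun x : Metric.closedBall (0 : A) 1 =>
    φ.eval A (Fin.cons (α := fun _ => A) (x : A) v))
    ⟨C, by rintro _ ⟨x, rfl⟩; exact (abs_le.1 (hC x)).2⟩
    ⟨x, mem_closedBall_zero_iff.2 hx⟩).trans h

theorem eval_inf_lt_iff {n : ℕ} (φ : CFormula (n + 1)) (v : Fin n → A) (r : ℝ) :
    (CFormula.inf φ).eval A v < r ↔
      ∃ x : A, ‖x‖ ≤ 1 ∧ φ.eval A (Fin.cons (α := fun _ => A) x v) < r := by
  have : Nonempty (Metric.closedBall (0 : A) 1) := ⟨⟨0, by simp⟩⟩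
  obtain ⟨C, hC⟩ := exists_bound_cons φ v
  constructor
  · intro h
    obtain ⟨x, hx⟩ := exists_lt_of_ciInf_lt h
    exact ⟨x, mem_closedBall_zero_iff.1 x.2, hx⟩
  · rintro ⟨x, hx, h⟩
    exact (ciInf_le (f := fun x : Metric.closedBall (0 : A) 1 =>
      φ.eval A (Fin.cons (α := fun _ => A) (x : A) v))
      ⟨-C, by rintro _ ⟨x, rfl⟩; exact (abs_le.1 (hC x)).1⟩
      ⟨x, mem_closedBall_zero_iff.2 hx⟩).trans_lt h

theorem eval_iterSup_le_iff {c : ℕ} (b : ℕ) (φ : CFormula (c + b)) (v : Fin c → A) (r : ℝ) :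
    (iterSup b φ).eval A v ≤ r ↔
      ∀ y : Fin b → A, (∀ j, ‖y j‖ ≤ 1) → φ.eval A (extend v y) ≤ r := by
  induction b with
  | zero =>
    refine ⟨fun h y _ => by rwa [extend_zero], fun h => ?_⟩
    have := h Fin.elim0 (fun j => j.elim0)
    rwa [extend_zero] at this
  | succ b ih =>
    rw [iterSup, ih]
    constructor
    · intro h y hy
      have := (eval_sup_le_iff _ _ _).1 (h (Fin.tail y) fun j => hy _) (y 0) (hy 0)
      rw [cons_extend] at this
      simpa [Fin.cons_self_tail] using! this
    · intro h y hy
      refine (eval_sup_le_iff _ _ _).2 fun x hx => ?_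
      rw [cons_extend]
      exact h _ fun j => Fin.cases (by simpa using hx) (fun i => by simpa using hy i) j

/-- An infimum need not be attained, so witnesses are extracted from strict inequalities only. -/
theorem eval_iterInf_lt_iff {c : ℕ} (b : ℕ) (φ : CFormula (c + b)) (v : Fin c → A) (r : ℝ) :
    (iterInf b φ).eval A v < r ↔
      ∃ y : Fin b → A, (∀ j, ‖y j‖ ≤ 1) ∧ φ.eval A (extend v y) < r := by
  induction b with
  | zero =>
    refine ⟨fun h => ⟨Fin.elim0, fun j => j.elim0, by rwa [extend_zero]⟩, ?_⟩
    rintro ⟨y, -, h⟩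
    rwa [extend_zero] at h
  | succ b ih =>
    rw [iterInf, ih]
    constructor
    · rintro ⟨y, hy, h⟩
      obtain ⟨x, hx, h⟩ := (eval_inf_lt_iff _ _ _).1 h
      rw [cons_extend] at h
      exact ⟨_, fun j => Fin.cases (by simpa using hx) (fun i => by simpa using hy i) j, h⟩
    · rintro ⟨y, hy, h⟩
      refine ⟨Fin.tail y, fun j => hy _, (eval_inf_lt_iff _ _ _).2 ⟨y 0, hy 0, ?_⟩⟩
      rw [cons_extend]
      simpa [Fin.cons_self_tail] using! h

theorem eval_iterInf_le_of_exists {c : ℕ} (b : ℕ) (φ : CFormula (c + b)) (v : Fin c → A) (r : ℝ)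
    (h : ∃ y : Fin b → A, (∀ j, ‖y j‖ ≤ 1) ∧ φ.eval A (extend v y) ≤ r) :
    (iterInf b φ).eval A v ≤ r := by
  obtain ⟨y, hy, h⟩ := h
  exact le_of_forall_gt fun s hs => (eval_iterInf_lt_iff b φ v s).2 ⟨y, hy, h.trans_lt hs⟩

end Semantics

/-! ### Transfer from matrix algebras -/

open scoped Matrix.Norms.L2Operator in
/-- A condition `∃ z ∀ x ∃ y, u(‖t(z, x, y)‖) ≤ 0`, with the quantifiers over the closed unit balls,
which holds in all matrix algebras holds approximately in every pseudomatricial C*-algebra. -/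
theorem IsPseudomatricial.transfer {A : Type u} [NonUnitalCStarAlgebra A]
    (hA : IsPseudomatricial A) {γ ι κ J : Type} [Fintype γ] [Fintype ι] [Fintype κ] [Fintype J]
    (t : ∀ {N : ℕ}, (γ → Fin N) → (ι → Fin N) → (κ → Fin N) → J → CTerm N)
    (u : (J → ℝ) → ℝ) (hu : Continuous u)
    (hM : ∀ n : ℕ, 1 ≤ n → ∃ z : γ → Matrix (Fin n) (Fin n) ℂ, (∀ k, ‖z k‖ ≤ 1) ∧
      ∀ x : ι → Matrix (Fin n) (Fin n) ℂ, (∀ i, ‖x i‖ ≤ 1) →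
      ∃ y : κ → Matrix (Fin n) (Fin n) ℂ, (∀ j, ‖y j‖ ≤ 1) ∧
      ∀ (N : ℕ) (Z : γ → Fin N) (X : ι → Fin N) (Y : κ → Fin N)
        (w : Fin N → Matrix (Fin n) (Fin n) ℂ), (∀ k, w (Z k) = z k) → (∀ i, w (X i) = x i) →
        (∀ j, w (Y j) = y j) → u (fun j => ‖(t Z X Y j).eval w‖) ≤ 0)
    (ε : ℝ) (hε : 0 < ε) :
    ∃ z : γ → A, (∀ k, ‖z k‖ ≤ 1) ∧ ∀ x : ι → A, (∀ i, ‖x i‖ ≤ 1) →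
      ∃ y : κ → A, (∀ j, ‖y j‖ ≤ 1) ∧
      ∃ (N : ℕ) (Z : γ → Fin N) (X : ι → Fin N) (Y : κ → Fin N) (w : Fin N → A),
        (∀ k, w (Z k) = z k) ∧ (∀ i, w (X i) = x i) ∧ (∀ j, w (Y j) = y j) ∧
        u (fun j => ‖(t Z X Y j).eval w‖) < ε := by
  classical
  let eγ := Fintype.equivFin γ
  let eι := Fintype.equivFin ι
  let eκ := Fintype.equivFin κ
  let eJ := Fintype.equivFin J
  let a := Fintype.card ι
  let b := Fintype.card κ
  let c := Fintype.card γ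
  let Z : γ → Fin (0 + c + a + b) := fun k => outerVar b (outerVar a (innerVar 0 (eγ k)))
  let X : ι → Fin (0 + c + a + b) := fun i => outerVar b (innerVar (0 + c) (eι i))
  let Y : κ → Fin (0 + c + a + b) := fun j => innerVar (0 + c + a) (eκ j)
  let φ : CFormula (0 + c + a + b) := .conn (k := Fintype.card J) (fun r => u (r ∘ eJ))
    (by fun_prop) (fun j => .norm (t Z X Y (eJ.symm j)))
  let ψ : CSentence := iterInf c (iterSup a (iterInf b φ))
  -- Pseudomatriciality speaks of the value zero only; truncation turns ψ ≤ 0 into an equation.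
  let χ : CSentence := .conn (k := 1) (fun r => max (r 0) 0) (by fun_prop) (fun _ => ψ)
  have hφ : ∀ {B : Type} [NonUnitalCStarAlgebra B] (w : Fin (0 + c + a + b) → B),
      φ.eval B w = u fun j => ‖(t Z X Y j).eval w‖ := by
    intro B _ w
    simp only [φ, CFormula.eval]
    congr 1
    funext j
    simp
  have hφ' : ∀ (w : Fin (0 + c + a + b) → A), φ.eval A w = u fun j => ‖(t Z X Y j).eval w‖ := by
    intro w
    simp only [φ, CFormula.eval]
    congr 1
    funext j
    simp
  have hχ : CSentence.value A χ = 0 := by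
    refine hA χ fun n hn => ?_
    change max (CFormula.eval _ ψ Fin.elim0) 0 = 0
    refine max_eq_right (eval_iterInf_le_of_exists _ _ _ _ ?_)
    obtain ⟨z, hz, h⟩ := hM n hn
    refine ⟨z ∘ eγ.symm, fun k => hz _, (eval_iterSup_le_iff _ _ _ _).2 fun x hx => ?_⟩
    refine eval_iterInf_le_of_exists _ _ _ _ ?_
    obtain ⟨y, hy, h⟩ := h (x ∘ eι) fun i => hx _
    refine ⟨y ∘ eκ.symm, fun k => hy _, ?_⟩
    rw [hφ]
    refine h _ Z X Y _ (fun k => ?_) (fun i => ?_) (fun j => ?_)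
    · simp only [Z, extend_outerVar, extend_innerVar]; simp
    · simp only [X, extend_outerVar, extend_innerVar]; simp
    · simp only [Y, extend_innerVar]; simp
  have hψ : ψ.eval A Fin.elim0 < ε := by
    have : max (CFormula.eval A ψ Fin.elim0) 0 = 0 := hχ
    exact (max_eq_right_iff.1 this).trans_lt hε
  obtain ⟨z, hz, h⟩ := (eval_iterInf_lt_iff _ _ _ _).1 hψ
  refine ⟨z ∘ eγ, fun k => hz _, fun x hx => ?_⟩
  -- The bound is the supremum itself, which is already strictly below ε.
  have h1 := (eval_iterSup_le_iff a (iterInf b φ) (extend Fin.elim0 z) _).1 le_rfl (x ∘ eι.symm) fun i => hx _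
  obtain ⟨y, hy, h2⟩ := (eval_iterInf_lt_iff _ _ _ _).1 (h1.trans_lt h)
  refine ⟨y ∘ eκ, fun k => hy _, _, Z, X, Y, _, fun k => ?_, fun i => ?_, fun j => ?_,
    (hφ' _).symm.trans_lt h2⟩
  · simp only [Z, extend_outerVar, extend_innerVar]; simp
  · simp only [X, extend_outerVar, extend_innerVar]; simp
  · simp only [Y, extend_innerVar]; simp

/-- The sum of finitely many terms. -/
def CTerm.finSum {N : ℕ} : (m : ℕ) → (Fin m → CTerm N) → CTerm N
  | 0, _ => .zero
  | m + 1, f => .add (f 0) (CTerm.finSum m fun i => f i.succ)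

theorem CTerm.eval_finSum {A : Type u} [NonUnitalCStarAlgebra A] {N : ℕ} (w : Fin N → A) (m : ℕ)
    (f : Fin m → CTerm N) : (CTerm.finSum m f).eval w = ∑ i, (f i).eval w := by
  induction m with
  | zero => simp [finSum, eval]
  | succ m ih => simp [finSum, eval, ih, Fin.sum_univ_succ]

/-- The difference of two terms. -/
def CTerm.sub {N : ℕ} (s t : CTerm N) : CTerm N := .add s (.smul (-1) t)

theorem CTerm.eval_sub {A : Type u} [NonUnitalCStarAlgebra A] {N : ℕ} (w : Fin N → A)
    (s t : CTerm N) : (s.sub t).eval w = s.eval w - t.eval w := by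
  simp [sub, eval, sub_eq_add_neg]

/-! ### Projections near almost idempotent elements -/

section Projections

variable {A : Type u} [NonUnitalCStarAlgebra A]

/-- The characteristic function of `(1/2, ∞)`, divided by the identity. -/
def spectralCut (t : ℝ) : ℝ := if 1 / 2 < t then t⁻¹ else 0

theorem spectralCut_mul_sq (t : ℝ) :
    (spectralCut t * t) * (spectralCut t * t) = spectralCut t * t := by
  unfold spectralCut
  split_ifs with h
  · have : t ≠ 0 := by linarith
    field_simp
  · simp

/-- On either side of 1/2, one factor of t (t - 1) has modulus at least 1/2 and the modulus of the
other is the error. -/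
theorem abs_spectralCut_mul_sub_le (t : ℝ) : |spectralCut t * t - t| ≤ 2 * |t * t - t| := by
  unfold spectralCut
  split_ifs with h
  · rw [inv_mul_cancel₀ (by linarith), show t * t - t = (1 - t) * (-t) by ring, abs_mul, abs_neg,
      abs_of_pos (show 0 < t by linarith)]
    nlinarith [abs_nonneg (1 - t)]
  · rw [zero_mul, zero_sub, abs_neg, show t * t - t = t * (t - 1) by ring, abs_mul,
      abs_of_nonpos (show t - 1 ≤ 0 by linarith)]
    nlinarith [abs_nonneg t]

/-- Continuity of the cut holds both for a finite spectrum and for a spectrum avoiding 1/2. The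
factorization `e = b * h` makes e a subprojection of p whenever `h * p = h`. -/
theorem exists_projection_near_of_continuousOn {h : A} (hh : IsSelfAdjoint h)
    (hc : ContinuousOn spectralCut (quasispectrum ℝ h)) :
    ∃ e b : A, IsStarProjection e ∧ ‖e - h‖ ≤ 2 * ‖h * h - h‖ ∧ e = b * h := by
  have h0 : spectralCut 0 = 0 := by simp [spectralCut]
  have hcf : ContinuousOn (fun t => spectralCut t * t) (quasispectrum ℝ h) :=
    hc.mul continuousOn_id
  have hid : cfcₙ (fun t : ℝ => t) h = h := cfcₙ_id' ℝ h
  have hsq : h * h - h = cfcₙ (fun t : ℝ => t * t - t) h := by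
    rw [cfcₙ_sub (fun t : ℝ => t * t) (fun t : ℝ => t) h,
      cfcₙ_mul (fun t : ℝ => t) (fun t : ℝ => t) h, hid]
  refine ⟨cfcₙ (fun t => spectralCut t * t) h, cfcₙ spectralCut h, ⟨?_, ?_⟩, ?_, ?_⟩
  · rw [IsIdempotentElem, ← cfcₙ_mul _ _ h hcf (by simp) hcf (by simp)]
    simp only [spectralCut_mul_sq]
  · exact cfcₙ_predicate _ h
  · have : cfcₙ (fun t => spectralCut t * t) h - h =
        cfcₙ (fun t => spectralCut t * t - t) h := by
      rw [cfcₙ_sub _ _ h hcf (by simp), hid]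
    rw [this]
    refine norm_cfcₙ_le fun t ht => (abs_spectralCut_mul_sub_le t).trans ?_
    rw [hsq]
    have := norm_apply_le_norm_cfcₙ (fun t : ℝ => t * t - t) h ht
    rw [Real.norm_eq_abs] at this
    linarith
  · rw [cfcₙ_mul spectralCut (fun t => t) h hc h0, hid]

/-- A selfadjoint element which is almost idempotent is close to a projection. -/
theorem exists_projection_near {h : A} (hh : IsSelfAdjoint h) (hd : ‖h * h - h‖ < 1 / 4) :
    ∃ e b : A, IsStarProjection e ∧ ‖e - h‖ ≤ 2 * ‖h * h - h‖ ∧ e = b * h := by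
  refine exists_projection_near_of_continuousOn hh fun t ht => ContinuousAt.continuousWithinAt ?_
  have hid : cfcₙ (fun t : ℝ => t) h = h := cfcₙ_id' ℝ h
  have hsq : h * h - h = cfcₙ (fun t : ℝ => t * t - t) h := by
    rw [cfcₙ_sub (fun t : ℝ => t * t) (fun t : ℝ => t) h,
      cfcₙ_mul (fun t : ℝ => t) (fun t : ℝ => t) h, hid]
  have h1 : |t * t - t| < 1 / 4 := by
    have := norm_apply_le_norm_cfcₙ (fun t : ℝ => t * t - t) h ht
    rw [← hsq] at this
    exact this.trans_lt hd
  -- At 1/2 the modulus of t² - t is exactly 1/4.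
  have h2 : t ≠ 1 / 2 := by
    rintro rfl
    norm_num [abs_lt] at h1
  rcases lt_or_gt_of_ne h2 with h3 | h3
  · refine (continuousAt_const (y := (0 : ℝ))).congr ?_
    filter_upwards [eventually_lt_nhds h3] with s hs
    simp only [spectralCut, if_neg hs.not_gt]
  · refine (continuousAt_inv₀ (show t ≠ 0 by linarith)).congr ?_
    filter_upwards [eventually_gt_nhds h3] with s hs
    simp only [spectralCut, if_pos hs]

theorem norm_eq_one_of_isStarProjection {p : A} (hp : IsStarProjection p) (h0 : p ≠ 0) :
    ‖p‖ = 1 := by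
  have h := CStarRing.norm_star_mul_self (x := p)
  rw [hp.isSelfAdjoint.star_eq, hp.isIdempotentElem.eq] at h
  have := norm_pos_iff.2 h0
  nlinarith

theorem isStarProjection_sub {p q : A} (hp : IsStarProjection p) (hq : IsStarProjection q)
    (h : q * p = q) : IsStarProjection (p - q) :=
  hq.sub_of_mul_eq_left hp h

end Projections

/-! ### Traces and rank-one projections of matrices -/

section Matrices

open scoped Matrix.Norms.L2Operator

variable {n : ℕ}

/-- In a matrix algebra, every selfadjoint element has a spectral projection nearby. -/
theorem exists_matrix_projection_near {h : Matrix (Fin n) (Fin n) ℂ} (hh : IsSelfAdjoint h) :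
    ∃ e : Matrix (Fin n) (Fin n) ℂ, IsStarProjection e ∧ ‖e - h‖ ≤ 2 * ‖h * h - h‖ := by
  have hfin : (quasispectrum ℝ h).Finite := by
    rw [quasispectrum_eq_spectrum_union_zero]
    exact Matrix.finite_real_spectrum.union (Set.finite_singleton 0)
  obtain ⟨e, -, h1, h2, -⟩ := exists_projection_near_of_continuousOn hh (hfin.continuousOn _)
  exact ⟨e, h1, h2⟩

theorem norm_apply_le_l2_opNorm (B : Matrix (Fin n) (Fin n) ℂ) (i j : Fin n) : ‖B i j‖ ≤ ‖B‖ := by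
  have h := B.l2_opNorm_mulVec (EuclideanSpace.single j 1)
  simp only [PiLp.norm_single, norm_one, mul_one] at h
  refine le_trans ?_ h
  refine le_trans (le_of_eq ?_) (PiLp.norm_apply_le _ i)
  simp

theorem norm_trace_le (B : Matrix (Fin n) (Fin n) ℂ) : ‖B.trace‖ ≤ n * ‖B‖ := by
  refine (norm_sum_le _ _).trans ?_
  refine (Finset.sum_le_sum fun i _ => norm_apply_le_l2_opNorm B i i).trans ?_
  simp

theorem one_le_norm_one_sub_of_trace_eq_zero (hn : 1 ≤ n) (B : Matrix (Fin n) (Fin n) ℂ)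
    (hB : B.trace = 0) : 1 ≤ ‖1 - B‖ := by
  have h := norm_trace_le (1 - B)
  rw [Matrix.trace_sub, hB, sub_zero, Matrix.trace_one, Fintype.card_fin] at h
  simp only [Complex.norm_natCast] at h
  have : (0 : ℝ) < n := by exact_mod_cast hn
  exact le_of_mul_le_mul_left (by simpa using h) this

theorem isStarProjection_vecMulVec {ξ : Fin n → ℂ} (hξ : star ξ ⬝ᵥ ξ = 1) :
    IsStarProjection (Matrix.vecMulVec ξ (star ξ)) := by
  refine ⟨?_, ?_⟩
  · simp [IsIdempotentElem, Matrix.vecMulVec_mul_vecMulVec, hξ]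
  · simp [IsSelfAdjoint, Matrix.star_eq_conjTranspose, Matrix.conjTranspose_vecMulVec]

theorem exists_unit_vector_of_projection {p : Matrix (Fin n) (Fin n) ℂ} (hp : IsStarProjection p)
    (h0 : p ≠ 0) : ∃ ξ : Fin n → ℂ, star ξ ⬝ᵥ ξ = 1 ∧ p.mulVec ξ = ξ := by
  obtain ⟨v, hv⟩ : ∃ v, p.mulVec v ≠ 0 := by
    by_contra! h
    exact h0 (Matrix.ext_of_mulVec_single fun i => by rw [h, Matrix.zero_mulVec])
  set η := p.mulVec v
  have hη : p.mulVec η = η := by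
    simp only [η, Matrix.mulVec_mulVec, hp.isIdempotentElem.eq]
  set r : ℝ := ‖WithLp.toLp 2 η‖ with hr
  have hr0 : r ≠ 0 := by simpa [r] using hv
  have hrr : star η ⬝ᵥ η = (r : ℂ) ^ 2 := by
    rw [dotProduct_comm, ← EuclideanSpace.inner_toLp_toLp, inner_self_eq_norm_sq_to_K]
    rfl
  refine ⟨(r⁻¹ : ℂ) • η, ?_, ?_⟩
  · rw [star_smul, smul_dotProduct, dotProduct_smul, hrr]
    have : (r : ℂ) ≠ 0 := by exact_mod_cast hr0
    simp
    field_simp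
  · rw [Matrix.mulVec_smul, hη]

end Matrices

open scoped Matrix.Norms.L2Operator

/-! ### The unit, and norm estimates for it -/

section Unit

variable {A : Type u} [NonUnitalCStarAlgebra A]

/-- The estimate is uniform on the unit ball, so two such elements, tested on each other, are close;
this makes the sequence in `exists_unit` Cauchy. -/
theorem IsPseudomatricial.exists_approximate_unit (hA : IsPseudomatricial A) {ε : ℝ} (hε : 0 < ε) :
    ∃ e : A, ‖e‖ ≤ 1 ∧ ∀ x : A, ‖x‖ ≤ 1 → ‖e * x - x‖ + ‖x * e - x‖ < ε := by
  obtain ⟨z, hz, h⟩ := hA.transfer (γ := Unit) (ι := Unit) (κ := Empty) (J := Bool)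
    (fun Z X _ j => if j then .sub (.mul (.var (Z ())) (.var (X ()))) (.var (X ()))
      else .sub (.mul (.var (X ())) (.var (Z ()))) (.var (X ())))
    (fun r => r true + r false) (by fun_prop)
    (by
      intro n hn
      refine ⟨fun _ => 1, fun _ => IsStarProjection.norm_le _ (.one _), fun x hx =>
        ⟨fun k => k.elim, fun k => k.elim, fun N Z X Y w hZ hX hY => ?_⟩⟩
      simp [CTerm.eval_sub, CTerm.eval, hZ])
    ε hε
  refine ⟨z (), hz _, fun x hx => ?_⟩
  obtain ⟨y, -, N, Z, X, Y, w, hZ, hX, -, h⟩ := h (fun _ => x) fun _ => hx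
  simpa [CTerm.eval_sub, CTerm.eval, hZ, hX] using h

theorem exists_smul_norm_le_one (x : A) : ∃ (r : ℝ) (y : A), 0 ≤ r ∧ ‖y‖ ≤ 1 ∧ x = (r : ℂ) • y := by
  by_cases hx : x = 0
  · exact ⟨0, 0, le_rfl, by simp, by simp [hx]⟩
  · have : (‖x‖ : ℂ) ≠ 0 := by simpa using hx
    refine ⟨‖x‖, (‖x‖ : ℂ)⁻¹ • x, norm_nonneg _, ?_, by rw [smul_inv_smul₀ this]⟩
    rw [norm_smul, norm_inv, Complex.norm_real, norm_norm,
      inv_mul_cancel₀ (norm_ne_zero_iff.2 hx)]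

/-- A pseudomatricial C*-algebra has a unit. -/
theorem IsPseudomatricial.exists_unit (hA : IsPseudomatricial A) :
    ∃ e : A, (∀ x : A, e * x = x) ∧ (∀ x : A, x * e = x) ∧ ‖e‖ ≤ 1 := by
  have hpos : ∀ n : ℕ, (0 : ℝ) < 1 / (n + 1) := fun n => by positivity
  choose e hb he using fun n : ℕ => hA.exists_approximate_unit (hpos n)
  have hl : ∀ x : A, Filter.Tendsto (fun n => e n * x) Filter.atTop (nhds x) := by
    intro x
    obtain ⟨r, y, hr, hy, rfl⟩ := exists_smul_norm_le_one x
    simp only [mul_smul_comm]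
    refine Filter.Tendsto.const_smul ?_ _
    refine tendsto_iff_norm_sub_tendsto_zero.2 (squeeze_zero (fun _ => norm_nonneg _)
      (fun n => ?_) tendsto_one_div_add_atTop_nhds_zero_nat)
    linarith [he n y hy, norm_nonneg (y * e n - y)]
  have hr : ∀ x : A, Filter.Tendsto (fun n => x * e n) Filter.atTop (nhds x) := by
    intro x
    obtain ⟨r, y, hr, hy, rfl⟩ := exists_smul_norm_le_one x
    simp only [smul_mul_assoc]
    refine Filter.Tendsto.const_smul ?_ _
    refine tendsto_iff_norm_sub_tendsto_zero.2 (squeeze_zero (fun _ => norm_nonneg _)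
      (fun n => ?_) tendsto_one_div_add_atTop_nhds_zero_nat)
    linarith [he n y hy, norm_nonneg (e n * y - y)]
  have hC : CauchySeq e := by
    refine cauchySeq_of_le_tendsto_0 (fun N : ℕ => 2 * (1 / ((N : ℝ) + 1))) (fun n m N hn hm => ?_)
      (by simpa using tendsto_one_div_add_atTop_nhds_zero_nat.const_mul (2 : ℝ))
    have h1 : (1 : ℝ) / (n + 1) ≤ 1 / (N + 1) := Nat.one_div_le_one_div hn
    have h2 : (1 : ℝ) / (m + 1) ≤ 1 / (N + 1) := Nat.one_div_le_one_div hm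
    have h3 := he n (e m) (hb m)
    have h4 := he m (e n) (hb n)
    have h5 : ‖e n - e m‖ ≤ ‖e n * e m - e n‖ + ‖e n * e m - e m‖ := by
      rw [← norm_neg (e n * e m - e n)]
      refine le_trans (le_of_eq ?_) (norm_add_le _ _)
      congr 1
      abel
    rw [dist_eq_norm]
    linarith [norm_nonneg (e m * e n - e n), norm_nonneg (e m * e n - e m)]
  obtain ⟨e', h⟩ := cauchySeq_tendsto_of_complete hC
  refine ⟨e', fun x => ?_, fun x => ?_, ?_⟩
  · exact tendsto_nhds_unique (h.mul_const x) (hl x)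
  · exact tendsto_nhds_unique (h.const_mul x) (hr x)
  · exact le_of_tendsto h.norm (Filter.Eventually.of_forall hb)

/-- The language has no constant for the unit, so a variable takes its place, with a penalty ‖x y -
y‖. In M_n the choice y = 1 makes the penalty ‖x - 1‖, which pays for replacing x by 1; in A at x =
e the penalty is zero for every y. -/
theorem IsPseudomatricial.one_le_norm_unit_sub (hA : IsPseudomatricial A) {e : A}
    (he : ∀ x : A, e * x = x) (he1 : ‖e‖ ≤ 1) (m : ℕ) (c : Fin m → ℂ) (x y : Fin m → A)
    (hx : ∀ i, ‖x i‖ ≤ 1) (hy : ∀ i, ‖y i‖ ≤ 1) :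
    1 ≤ ‖e - ∑ i, c i • (x i * y i - y i * x i)‖ := by
  refine le_of_forall_pos_lt_add fun ε hε => ?_
  obtain ⟨_, -, h⟩ := hA.transfer (γ := Empty) (ι := Option (Fin m ⊕ Fin m)) (κ := Unit) (J := Bool)
    (fun Z X Y j => if j then .sub (.var (X none)) (.finSum m fun i => .smul (c i)
        (.sub (.mul (.var (X (some (.inl i)))) (.var (X (some (.inr i)))))
          (.mul (.var (X (some (.inr i)))) (.var (X (some (.inl i)))))))
      else .sub (.mul (.var (X none)) (.var (Y ()))) (.var (Y ())))
    (fun r => 1 - r true - r false) (by fun_prop)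
    (by
      intro n hn
      refine ⟨fun k => k.elim, fun k => k.elim, fun v hv => ⟨fun _ => 1,
        fun _ => IsStarProjection.norm_le _ (.one _), fun N Z X Y w hZ hX hY => ?_⟩⟩
      simp only [CTerm.eval_sub, CTerm.eval_finSum, CTerm.eval, hX, hY, if_true, mul_one,
        Bool.false_eq_true, if_false]
      set B := ∑ i, c i • (v (some (.inl i)) * v (some (.inr i)) -
        v (some (.inr i)) * v (some (.inl i))) with hB
      have hB0 : B.trace = 0 := by
        rw [hB, Matrix.trace_sum]
        refine Finset.sum_eq_zero fun i _ => ?_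
        rw [Matrix.trace_smul, Matrix.trace_sub, Matrix.trace_mul_comm, sub_self, smul_zero]
      have h1 := one_le_norm_one_sub_of_trace_eq_zero hn B hB0
      have h2 : ‖1 - B‖ ≤ ‖v none - B‖ + ‖v none - 1‖ := by
        rw [← norm_neg (v none - 1)]
        refine le_trans (le_of_eq ?_) (norm_add_le _ _)
        congr 1
        abel
      linarith)
    ε hε
  obtain ⟨_, -, N, Z, X, Y, w, -, hX, hY, h⟩ :=
    h (fun j => j.elim e (Sum.elim x y)) (by rintro (_ | _ | _) <;> simp [he1, hx, hy])
  simp only [CTerm.eval_sub, CTerm.eval_finSum, CTerm.eval, hX, hY, if_true, he,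
    Bool.false_eq_true, if_false, Option.elim, Sum.elim_inl, Sum.elim_inr, sub_self,
    norm_zero] at h
  linarith

theorem norm_one_sub_star_mul_self_le {B : Type u} [CStarAlgebra B] {b : B} (hb : ‖b‖ ≤ 1) :
    ‖1 - star b * b‖ ≤ 1 := by
  let _ : PartialOrder B := CStarAlgebra.spectralOrder B
  have : StarOrderedRing B := CStarAlgebra.spectralOrderedRing B
  have h0 : 0 ≤ star b * b := star_mul_self_nonneg b
  have h1 : star b * b ≤ 1 := by
    rw [← CStarAlgebra.norm_le_one_iff_of_nonneg _ h0, CStarRing.norm_star_mul_self]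
    exact mul_le_one₀ hb (norm_nonneg _) hb
  rw [CStarAlgebra.norm_le_one_iff_of_nonneg _ (sub_nonneg.2 h1)]
  exact sub_le_self _ h0

/-- The same penalty as in `one_le_norm_unit_sub` replaces the unit; the bound serves to prove the
trace positive. -/
theorem IsPseudomatricial.norm_unit_sub_le (hA : IsPseudomatricial A) {e : A}
    (he : ∀ x : A, e * x = x) (he1 : ‖e‖ ≤ 1) (b : A) (hb : ‖b‖ ≤ 1) :
    ‖e - star b * b‖ ≤ 1 := by
  refine le_of_forall_pos_lt_add fun ε hε => ?_
  obtain ⟨_, -, h⟩ := hA.transfer (γ := Empty) (ι := Bool) (κ := Unit) (J := Bool)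
    (fun Z X Y j => if j then .sub (.var (X true)) (.mul (.star (.var (X false))) (.var (X false)))
      else .sub (.mul (.var (X true)) (.var (Y ()))) (.var (Y ())))
    (fun r => r true - 1 - r false) (by fun_prop)
    (by
      intro n hn
      refine ⟨fun k => k.elim, fun k => k.elim, fun v hv => ⟨fun _ => 1,
        fun _ => IsStarProjection.norm_le _ (.one _), fun N Z X Y w hZ hX hY => ?_⟩⟩
      simp only [CTerm.eval_sub, CTerm.eval, hX, hY, if_true, mul_one,
        Bool.false_eq_true, if_false]
      have h1 : ‖1 - star (v false) * v false‖ ≤ 1 := norm_one_sub_star_mul_self_le (hv _)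
      have h2 : ‖v true - star (v false) * v false‖ ≤
          ‖v true - 1‖ + ‖1 - star (v false) * v false‖ := norm_sub_le_norm_sub_add_norm_sub _ _ _
      linarith)
    ε hε
  obtain ⟨_, -, N, Z, X, Y, w, -, hX, hY, h⟩ :=
    h (fun j => if j then e else b) (by rintro (_ | _) <;> simp [he1, hb])
  simp only [CTerm.eval_sub, CTerm.eval, hX, hY, if_true, he,
    Bool.false_eq_true, if_false, sub_self, norm_zero] at h
  linarith

end Unit

/-! ### Existence of a tracial state -/

section Trace

variable {A : Type u} [NonUnitalCStarAlgebra A]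

/-- Adding i t e to s shifts the imaginary part of τ(s) by t, while the square of the norm grows by
at most t². For large t of the appropriate sign this forces the imaginary part to vanish. -/
theorem apply_isSelfAdjoint_im_eq_zero {e : A} (he : ∀ x : A, e * x = x) (he' : ∀ x : A, x * e = x)
    (he1 : ‖e‖ ≤ 1) {τ : A →L[ℂ] ℂ} (hτ : ‖τ‖ ≤ 1) (hτe : τ e = 1) {s : A}
    (hs : IsSelfAdjoint s) : (τ s).im = 0 := by
  have hse : star e = e := 
    (he (star e)).symm.trans (by simpa using congrArg star (he (star e)))
  have key : ∀ t : ℝ, ((τ s).im + t) ^ 2 ≤ ‖s‖ ^ 2 + t ^ 2 := by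
    intro t
    set c : ℂ := Complex.I * t with hc
    have hc1 : star c = -c := by simp [hc]
    have hc2 : c * c = -(t : ℂ) ^ 2 := by linear_combination (t : ℂ) ^ 2 * Complex.I_sq
    set x : A := s + c • e
    have h1 : star x * x = s * s + ((t : ℂ) ^ 2) • e := by
      simp only [x, star_add, star_smul, hse, hs.star_eq, mul_add, add_mul, smul_mul_assoc,
        mul_smul_comm, he, he', hc1, neg_smul, neg_mul, smul_add, smul_neg, smul_smul, hc2]
      abel
    have h2 : ‖x‖ ^ 2 ≤ ‖s‖ ^ 2 + t ^ 2 := by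
      rw [sq, ← CStarRing.norm_star_mul_self, h1]
      refine (norm_add_le _ _).trans (add_le_add ?_ ?_)
      · rw [sq]
        exact norm_mul_le _ _
      · rw [norm_smul, norm_pow, Complex.norm_real, Real.norm_eq_abs, sq_abs]
        exact mul_le_of_le_one_right (sq_nonneg _) he1
    have h3 : ‖τ x‖ ≤ ‖x‖ := by
      simpa using (τ.le_opNorm x).trans (mul_le_mul_of_nonneg_right hτ (norm_nonneg _))
    have h4 : (τ x).im = (τ s).im + t := by
      simp [x, hτe, hc]
    have h5 : |(τ x).im| ≤ ‖x‖ := (Complex.abs_im_le_norm _).trans h3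
    rw [h4] at h5
    rw [← sq_abs]
    exact (pow_le_pow_left₀ (abs_nonneg _) h5 2).trans h2
  by_contra h0
  have h1 := key ((‖s‖ ^ 2 + 1) / (2 * (τ s).im))
  have h2 : 2 * (τ s).im * ((‖s‖ ^ 2 + 1) / (2 * (τ s).im)) = ‖s‖ ^ 2 + 1 := by
    field_simp
  nlinarith [sq_nonneg (τ s).im]

/-- A pseudomatricial C*-algebra has a tracial state. -/
theorem IsPseudomatricial.exists_isTracialState (hA : IsPseudomatricial A) :
    ∃ τ : A →L[ℂ] ℂ, IsTracialState τ := by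
  obtain ⟨e, he, he', he1⟩ := hA.exists_unit
  let T : Set A := {a | ∃ x y : A, ‖x‖ ≤ 1 ∧ ‖y‖ ≤ 1 ∧ a = x * y - y * x}
  let S : Submodule ℂ A := Submodule.span ℂ T
  have hS : ∀ a ∈ S, 1 ≤ ‖e - a‖ := by
    intro a ha
    obtain ⟨m, c, g, rfl⟩ := Submodule.mem_span_set'.1 ha
    choose x y hx hy hxy using fun i => (g i).2
    simp only [hxy]
    exact hA.one_le_norm_unit_sub he he1 m c x y hx hy
  have hge : 1 ≤ ‖(S.mkQ e : A ⧸ S)‖ := by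
    refine le_of_forall_pos_lt_add fun ε hε => ?_
    obtain ⟨a, ha, h⟩ := Submodule.Quotient.norm_mk_lt (S.mkQ e : A ⧸ S) hε
    refine lt_of_le_of_lt ?_ h
    simpa using hS (e - a) ((Submodule.Quotient.eq S).1 ha.symm)
  -- A norming functional of the class of e, pulled back to A, vanishes on commutators.
  obtain ⟨g, hg, hge'⟩ := exists_dual_vector ℂ (S.mkQ e : A ⧸ S) (by linarith)
  have hQ : ∀ x : A, ‖g (S.mkQ x)‖ ≤ 1 * ‖x‖ := fun x =>
    (g.le_opNorm _).trans (by rw [hg]; gcongr; exact Submodule.Quotient.norm_mk_le S x)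
  let τ : A →L[ℂ] ℂ := ((g : (A ⧸ S) →ₗ[ℂ] ℂ).comp S.mkQ).mkContinuous 1 hQ
  have hτ : ‖τ‖ ≤ 1 := LinearMap.mkContinuous_norm_le _ zero_le_one _
  have hτe : τ e = 1 := by
    have h1 : ‖(S.mkQ e : A ⧸ S)‖ = 1 :=
      le_antisymm ((Submodule.Quotient.norm_mk_le S e).trans he1) hge
    change g (S.mkQ e) = 1
    rw [hge', h1]
    simp
  have hT : ∀ x y : A, ‖x‖ ≤ 1 → ‖y‖ ≤ 1 → τ (x * y) = τ (y * x) := by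
    intro x y hx hy
    rw [← sub_eq_zero, ← map_sub]
    change g (S.mkQ (x * y - y * x)) = 0
    rw [Submodule.mkQ_apply, (Submodule.Quotient.mk_eq_zero S).2, map_zero]
    exact Submodule.subset_span ⟨x, y, hx, hy, rfl⟩
  refine ⟨τ, fun a => ?_, le_antisymm hτ ?_, fun a b => ?_⟩
  · obtain ⟨r, b, hr, hb, rfl⟩ := exists_smul_norm_le_one a
    have h1 : (τ (star b * b)).im = 0 :=
      apply_isSelfAdjoint_im_eq_zero he he' he1 hτ hτe (.star_mul_self b)
    -- A number within distance one of 1 has nonnegative real part.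
    have h2 : ‖1 - τ (star b * b)‖ ≤ 1 := by
      rw [← hτe, ← map_sub]
      refine (τ.le_opNorm _).trans (mul_le_one₀ hτ (norm_nonneg _) ?_)
      exact hA.norm_unit_sub_le he he1 b hb
    have h3 : 0 ≤ (τ (star b * b)).re := by
      have := (Complex.re_le_norm _).trans h2
      simp only [Complex.sub_re, Complex.one_re] at this
      linarith
    have h4 : τ (star ((r : ℂ) • b) * ((r : ℂ) • b)) = (r : ℂ) * r * τ (star b * b) := by
      simp [star_smul, smul_mul_assoc, mul_smul_comm, mul_assoc]
    rw [h4, Complex.nonneg_iff]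
    simp [h1]
    positivity
  · have := τ.le_opNorm e
    rw [hτe, norm_one] at this
    exact this.trans (mul_le_of_le_one_right (norm_nonneg _) he1)
  · obtain ⟨r, x, hr, hx, rfl⟩ := exists_smul_norm_le_one a
    obtain ⟨s, y, hs, hy, rfl⟩ := exists_smul_norm_le_one b
    simp only [smul_mul_assoc, mul_smul_comm, map_smul, hT x y hx hy]
    exact smul_comm _ _ _

end Trace

/-! ### Existence of a minimal projection -/

section MinimalProjections

variable {A : Type u} [NonUnitalCStarAlgebra A]

theorem one_sub_le_norm_compression {P e q : A} (hP : ‖P‖ ≤ 1) (hq : ‖q‖ = 1) (heq : e * q = q)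
    (hqe : q * e = q) : 1 - 2 * ‖e - P‖ ≤ ‖P * q * P‖ := by
  have h1 : q = P * q * P + ((e - P) * q * P + q * (e - P)) := by
    simp only [sub_mul, mul_sub, heq, hqe]
    abel
  have h2 : ‖(e - P) * q * P‖ ≤ ‖e - P‖ := by
    refine (norm_mul_le _ _).trans ((mul_le_of_le_one_right (norm_nonneg _) hP).trans ?_)
    simpa [hq] using norm_mul_le (e - P) q
  have h3 : ‖q * (e - P)‖ ≤ ‖e - P‖ := by simpa [hq] using norm_mul_le q (e - P)
  have h4 := (norm_add_le (P * q * P) ((e - P) * q * P + q * (e - P)))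
  rw [← h1, hq] at h4
  linarith [norm_add_le ((e - P) * q * P) (q * (e - P))]

theorem norm_compression_mul_le {P e q r : A} (hP : ‖P‖ ≤ 1) (hq : ‖q‖ = 1) (hr : ‖r‖ = 1)
    (hqe : q * e = q) (hqr : q * r = 0) : ‖P * q * P * (P * r * P)‖ ≤ 2 * ‖e - P‖ := by
  have h1 : q * P * (P * r) = -(q * (e - P) * (P * r)) - q * (e - P) * r := by
    simp only [sub_mul, mul_sub, hqe, hqr, ← mul_assoc]
    abel
  have h2 : ‖q * (e - P)‖ ≤ ‖e - P‖ := by simpa [hq] using norm_mul_le q (e - P)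
  have h3 : ‖P * r‖ ≤ 1 := (norm_mul_le _ _).trans (by simpa [hr] using hP)
  have h4 : ‖q * P * (P * r)‖ ≤ 2 * ‖e - P‖ := by
    rw [h1]
    refine (norm_sub_le _ _).trans ?_
    rw [norm_neg]
    have h5 : ‖q * (e - P) * (P * r)‖ ≤ ‖e - P‖ :=
      (norm_mul_le _ _).trans ((mul_le_of_le_one_right (norm_nonneg _) h3).trans h2)
    have h6 : ‖q * (e - P) * r‖ ≤ ‖e - P‖ :=
      (norm_mul_le _ _).trans (by rw [hr, mul_one]; exact h2)
    linarith
  have h7 : P * q * P * (P * r * P) = P * (q * P * (P * r)) * P := by simp only [mul_assoc]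
  rw [h7]
  refine (norm_mul_le _ _).trans ((mul_le_of_le_one_right (norm_nonneg _) hP).trans ?_)
  refine (norm_mul_le _ _).trans ((mul_le_of_le_one_left (norm_nonneg _) hP).trans h4)

/-- A rank-one projection p of M_n satisfies p x p ∈ ℂ p, so ‖p x p‖ ‖p y p‖ = ‖p x p y p‖. The form
g* g keeps the witness selfadjoint in A without a further condition. -/
theorem IsPseudomatricial.exists_almost_prime (hA : IsPseudomatricial A) {ε : ℝ} (hε : 0 < ε) :
    ∃ g : A, ‖g‖ ≤ 1 ∧ ∀ x y : A, ‖x‖ ≤ 1 → ‖y‖ ≤ 1 →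
      ‖star g * g * (star g * g) - star g * g‖ + |1 - ‖star g * g‖| +
        max (‖star g * g * x * (star g * g)‖ * ‖star g * g * y * (star g * g)‖ -
          ‖star g * g * x * (star g * g) * (star g * g * y * (star g * g))‖) 0 < ε := by
  obtain ⟨z, hz, h⟩ := hA.transfer (γ := Unit) (ι := Bool) (κ := Empty) (J := Fin 5)
    (fun Z X _ j =>
      let P : CTerm _ := .mul (.star (.var (Z ()))) (.var (Z ()))
      let S : CTerm _ := .mul (.mul P (.var (X true))) P
      let T : CTerm _ := .mul (.mul P (.var (X false))) P
      ![.sub (.mul P P) P, P, S, T, .mul S T] j)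
    (fun r => r 0 + |1 - r 1| + max (r 2 * r 3 - r 4) 0) (by fun_prop)
    (by
      intro n hn
      let i : Fin n := ⟨0, hn⟩
      let p : Matrix (Fin n) (Fin n) ℂ := Matrix.single i i 1
      have hp : IsStarProjection p := by
        refine ⟨by simp [p, IsIdempotentElem], ?_⟩
        simp [p, IsSelfAdjoint, Matrix.star_eq_conjTranspose]
      have hp0 : p ≠ 0 := fun h => by simpa [p] using congrFun (congrFun h i) i
      have hp1 : ‖p‖ = 1 := norm_eq_one_of_isStarProjection hp hp0
      have hpp : star p * p = p := by rw [hp.isSelfAdjoint.star_eq, hp.isIdempotentElem.eq]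
      have hc : ∀ x : Matrix (Fin n) (Fin n) ℂ, p * x * p = x i i • p := by
        intro x
        simp [p]
      refine ⟨fun _ => p, fun _ => hp1.le, fun x hx =>
        ⟨fun k => k.elim, fun k => k.elim, fun N Z X Y w hZ hX hY => ?_⟩⟩
      simp [CTerm.eval_sub, CTerm.eval, hZ, hX, hpp, hp.isIdempotentElem.eq, hp1, hc, norm_smul]
      exact (mul_comm _ _).le)
    ε hε
  refine ⟨z (), hz _, fun x y hx hy => ?_⟩
  obtain ⟨_, -, N, Z, X, Y, w, hZ, hX, -, h⟩ := h (fun j => if j then x else y)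
    (by rintro (_ | _) <;> simp [hx, hy])
  simpa [CTerm.eval_sub, CTerm.eval, hZ, hX] using h

/-- A pseudomatricial C*-algebra has a minimal projection. -/
theorem IsPseudomatricial.exists_isMinimalProjection (hA : IsPseudomatricial A) :
    ∃ p : A, IsMinimalProjection p := by
  obtain ⟨g, hg, h⟩ := hA.exists_almost_prime (ε := 1 / 100) (by norm_num)
  set P := star g * g with hP
  have hP1 : ‖P‖ ≤ 1 := by
    rw [hP, CStarRing.norm_star_mul_self]
    exact mul_le_one₀ hg (norm_nonneg _) hg
  have h0 := h 0 0 (by simp) (by simp)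
  simp only [mul_zero, zero_mul, norm_zero, sub_zero, max_self, add_zero] at h0
  have h1 := abs_nonneg (1 - ‖P‖)
  have h2 := le_abs_self (1 - ‖P‖)
  have h3 := norm_nonneg (P * P - P)
  obtain ⟨e, b, he, hd, -⟩ := exists_projection_near (IsSelfAdjoint.star_mul_self g)
    (show ‖P * P - P‖ < 1 / 4 by linarith)
  have hd' : ‖e - P‖ ≤ 1 / 50 := by linarith
  refine ⟨e, he, ?_, fun q hq hqe => ?_⟩
  · rintro rfl
    rw [zero_sub, norm_neg] at hd'
    linarith
  · by_contra! hne
    have heq : e * q = q := by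
      simpa [he.isSelfAdjoint.star_eq, hq.isSelfAdjoint.star_eq] using congrArg star hqe
    have hr := isStarProjection_sub he hq hqe
    have hq1 := norm_eq_one_of_isStarProjection hq hne.1
    have hr1 := norm_eq_one_of_isStarProjection hr (sub_ne_zero.2 hne.2.symm)
    -- The compressions of the orthogonal projections q and e - q have norm at least 24/25, but
    -- their product has norm at most 1/25; this contradicts almost multiplicativity.
    have h4 := h q (e - q) hq1.le hr1.le
    have h5 := one_sub_le_norm_compression hP1 hq1 heq hqe
    have h6 := one_sub_le_norm_compression (e := e) hP1 hr1
      (by rw [mul_sub, heq, he.isIdempotentElem.eq])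
      (by rw [sub_mul, hqe, he.isIdempotentElem.eq])
    have h7 := norm_compression_mul_le hP1 hq1 hr1 hqe
      (by rw [mul_sub, hqe, hq.isIdempotentElem.eq, sub_self])
    have h8 := le_max_left (‖P * q * P‖ * ‖P * (e - q) * P‖ - ‖P * q * P * (P * (e - q) * P)‖) 0
    have h9 : (24 / 25 : ℝ) * (24 / 25) ≤ ‖P * q * P‖ * ‖P * (e - q) * P‖ :=
      mul_le_mul (by linarith) (by linarith) (by norm_num) (norm_nonneg _)
    norm_num at h9
    linarith

end MinimalProjections

/-! ### Orthogonal copies of a minimal projection -/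

section Copies

theorem exists_close_pair_of_finiteDimensional (E : Type u) [NormedAddCommGroup E]
    [NormedSpace ℂ E] [FiniteDimensional ℂ E] :
    ∃ k : ℕ, ∀ m : ℕ, k ≤ m → ∀ z : Fin m → E, (∀ i, ‖z i‖ ≤ 1) →
      ∃ i j, i ≠ j ∧ ‖z i - z j‖ ≤ 1 / 2 := by
  have : ProperSpace E := FiniteDimensional.proper ℂ E
  obtain ⟨t, -, ht, hcover⟩ := (isCompact_closedBall (0 : E) 1).finite_cover_balls
    (e := 1 / 4) (by norm_num)
  have : Fintype t := ht.fintype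
  refine ⟨Fintype.card t + 1, fun m hm z hz => ?_⟩
  have h : ∀ i, ∃ c : t, dist (z i) c < 1 / 4 := by
    intro i
    have := hcover (mem_closedBall_zero_iff.2 (hz i))
    simp only [Set.mem_iUnion, Metric.mem_ball, exists_prop] at this
    obtain ⟨c, hc, h⟩ := this
    exact ⟨⟨c, hc⟩, h⟩
  choose c hc using h
  obtain ⟨i, j, hij, h⟩ := Fintype.exists_ne_map_eq_of_card_lt c (by simpa using hm)
  refine ⟨i, j, hij, ?_⟩
  rw [← dist_eq_norm]
  have h1 := hc i
  have h2 := hc j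
  rw [← h] at h2
  linarith [dist_triangle_right (z i) (z j) (c i)]

theorem exists_close_pair_matrix (K : ℕ) :
    ∃ m : ℕ, ∀ n < K, ∀ z : Fin m → Matrix (Fin n) (Fin n) ℂ, (∀ i, ‖z i‖ ≤ 1) →
      ∃ i j, i ≠ j ∧ ‖z i - z j‖ ≤ 1 / 2 := by
  choose k hk using fun n : ℕ => exists_close_pair_of_finiteDimensional (Matrix (Fin n) (Fin n) ℂ)
  exact ⟨(Finset.range K).sup k, fun n hn => hk n _ (Finset.le_sup (Finset.mem_range.2 hn))⟩

theorem exists_separated_of_not_finiteDimensional {E : Type u} [NormedAddCommGroup E]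
    [NormedSpace ℂ E] (h : ¬ FiniteDimensional ℂ E) (m : ℕ) :
    ∃ z : Fin m → E, (∀ i, ‖z i‖ ≤ 1) ∧ ∀ i j, i ≠ j → 2 / 3 ≤ ‖z i - z j‖ := by
  -- Riesz's lemma gives 1-separated points of norm at most 3/2; scaling by 2/3 puts them in the
  -- unit ball.
  obtain ⟨f, hf, hsep⟩ := exists_seq_norm_le_one_le_norm_sub' (𝕜 := ℂ) (c := 5 / 4) (R := 3 / 2)
    (by norm_num) (by norm_num) h
  refine ⟨fun i => (2 / 3 : ℂ) • f i, fun i => ?_, fun i j hij => ?_⟩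
  · rw [norm_smul]
    have := hf i
    norm_num
    linarith
  · rw [← smul_sub, norm_smul]
    have := hsep (Fin.val_ne_of_ne hij)
    norm_num
    linarith

/-- In `M_n(ℂ)`, `n ≥ K`, a projection either has a nontrivial subprojection or is equivalent to `K`
orthogonal projections. -/
theorem exists_subprojection_or_copies {n K : ℕ} (hK : K ≤ n) {p : Matrix (Fin n) (Fin n) ℂ}
    (hp : IsStarProjection p) :
    (∃ q, IsStarProjection q ∧ q * p = q ∧ ‖q‖ = 1 ∧ ‖p - q‖ = 1) ∨
    ∃ v : Fin K → Matrix (Fin n) (Fin n) ℂ, (∀ i, ‖v i‖ ≤ 1) ∧ (∀ i, star (v i) * v i = p) ∧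
      ‖∑ i, v i * star (v i)‖ ≤ 1 := by
  by_cases h0 : p = 0
  · exact .inr ⟨0, by simp, by simp [h0], by simp⟩
  obtain ⟨ξ, hξ, hpξ⟩ := exists_unit_vector_of_projection hp h0
  set q := Matrix.vecMulVec ξ (star ξ) with hq
  have hqp : IsStarProjection q := isStarProjection_vecMulVec hξ
  have hpq : p * q = q := by rw [hq, Matrix.mul_vecMulVec, hpξ]
  have hqp' : q * p = q := by
    simpa [hp.isSelfAdjoint.star_eq, hqp.isSelfAdjoint.star_eq] using congrArg star hpq
  have hq0 : q ≠ 0 := by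
    intro h
    have := congrArg Matrix.trace h
    rw [hq, Matrix.trace_vecMulVec, dotProduct_comm, hξ] at this
    simp at this
  by_cases hqeq : p = q
  · right
    -- Here p = ξ ξ* has rank one, and the partial isometries e_i ξ* carry it to the coordinate
    -- projections e_i e_i*.
    have hv : ∀ i : Fin K, star (Matrix.vecMulVec (Pi.single (Fin.castLE hK i) 1) (star ξ)) *
        Matrix.vecMulVec (Pi.single (Fin.castLE hK i) 1) (star ξ) = p := by
      intro i
      rw [Matrix.star_eq_conjTranspose, Matrix.conjTranspose_vecMulVec,
        Matrix.vecMulVec_mul_vecMulVec, star_star, hqeq, hq]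
      simp
    refine ⟨fun i => Matrix.vecMulVec (Pi.single (Fin.castLE hK i) 1) (star ξ), fun i => ?_, hv, ?_⟩
    · refine (sq_le_one_iff₀ (norm_nonneg _)).1 ?_
      rw [sq, ← CStarRing.norm_star_mul_self, hv]
      exact hp.norm_le
    · have hd : ∑ i : Fin K, Matrix.vecMulVec (Pi.single (Fin.castLE hK i) 1) (star ξ) *
          star (Matrix.vecMulVec (Pi.single (Fin.castLE hK i) 1) (star ξ)) =
          Matrix.diagonal fun j : Fin n => if (j : ℕ) < K then (1 : ℂ) else 0 := by
        have h1 : ∀ i : Fin K, Matrix.vecMulVec (Pi.single (Fin.castLE hK i) 1) (star ξ) *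
            star (Matrix.vecMulVec (Pi.single (Fin.castLE hK i) 1) (star ξ)) =
            Matrix.diagonal (Pi.single (Fin.castLE hK i) (1 : ℂ)) := by
          intro i
          rw [Matrix.star_eq_conjTranspose, Matrix.conjTranspose_vecMulVec,
            Matrix.vecMulVec_mul_vecMulVec, star_star, hξ, one_smul]
          ext a b
          simp only [Matrix.vecMulVec_apply, Matrix.diagonal_apply, Pi.single_apply, Pi.star_apply]
          split_ifs <;> simp_all
        simp only [h1]
        ext a b
        rw [Matrix.sum_apply]
        by_cases hab : a = b
        · subst hab
          simp only [Matrix.diagonal_apply_eq]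
          split_ifs with ha
          · rw [Finset.sum_eq_single ⟨a, ha⟩]
            · simp
            · intro c _ hc
              refine Pi.single_eq_of_ne (fun h => hc ?_) _
              ext
              simp [h]
            · simp
          · refine Finset.sum_eq_zero fun c _ => Pi.single_eq_of_ne (fun h => ha ?_) _
            rw [h]
            exact c.2
        · simp [Matrix.diagonal_apply_ne _ hab]
      rw [hd, Matrix.l2_opNorm_diagonal, pi_norm_le_iff_of_nonneg zero_le_one]
      intro j
      split_ifs <;> simp
  · exact .inl ⟨q, hqp, hqp', norm_eq_one_of_isStarProjection hqp hq0,
      norm_eq_one_of_isStarProjection (isStarProjection_sub hp hqp hqp') (sub_ne_zero.2 hqeq)⟩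

variable {A : Type u} [NonUnitalCStarAlgebra A]

/-- The elements whose norms express the alternative of `exists_subprojection_or_copies`, with `p`
a projection near `h = x* x`, `y` an element such that `H = (y p)* (y p)` is a subprojection of `p`,
and `v` a family of partial isometries with initial projection `p`; and the differences of the `z`. -/
def alternativeElement {K m : ℕ} (x : Unit ⊕ Fin m → A) (y : Bool ⊕ Fin K → A) :
    Fin 6 ⊕ Fin K ⊕ (Fin m × Fin m) → A :=
  let h := star (x (.inl ())) * x (.inl ())
  let p := y (.inl true)
  let H := star (y (.inl false) * p) * (y (.inl false) * p)
  Sum.elim ![p - h, h * h - h, H * H - H, H, p - H, ∑ i, y (.inr i) * star (y (.inr i))]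
    (Sum.elim (fun i => star (y (.inr i)) * y (.inr i) - p)
      fun ij => x (.inr ij.1) - x (.inr ij.2))

/-- The terms which define `alternativeElement`. -/
def alternativeTerm {K m N : ℕ} (X : Unit ⊕ Fin m → Fin N) (Y : Bool ⊕ Fin K → Fin N) :
    Fin 6 ⊕ Fin K ⊕ (Fin m × Fin m) → CTerm N :=
  let w : CTerm N := .var (X (.inl ()))
  let h : CTerm N := .mul (.star w) w
  let p : CTerm N := .var (Y (.inl true))
  let a : CTerm N := .mul (.var (Y (.inl false))) p
  let H : CTerm N := .mul (.star a) a
  let v : Fin K → CTerm N := fun i => .var (Y (.inr i))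
  Sum.elim ![.sub p h, .sub (.mul h h) h, .sub (.mul H H) H, H, .sub p H,
    .finSum K fun i => .mul (v i) (.star (v i))]
    (Sum.elim (fun i => .sub (.mul (.star (v i)) (v i)) p)
      fun ij => .sub (.var (X (.inr ij.1))) (.var (X (.inr ij.2))))

theorem eval_alternativeTerm {K m N : ℕ} {X : Unit ⊕ Fin m → Fin N} {Y : Bool ⊕ Fin K → Fin N}
    {w : Fin N → A} {x : Unit ⊕ Fin m → A} {y : Bool ⊕ Fin K → A} (hX : ∀ i, w (X i) = x i)
    (hY : ∀ j, w (Y j) = y j) (j : Fin 6 ⊕ Fin K ⊕ (Fin m × Fin m)) :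
    (alternativeTerm X Y j).eval w = alternativeElement x y j := by
  rcases j with j | i | ij
  · fin_cases j <;> simp only [alternativeTerm, alternativeElement, Sum.elim_inl,
      Fin.zero_eta, Fin.mk_one, Fin.reduceFinMk, Matrix.cons_val,
      CTerm.eval_sub, CTerm.eval_finSum, CTerm.eval, hX, hY]
  · simp only [alternativeTerm, alternativeElement, Sum.elim_inl, Sum.elim_inr,
      CTerm.eval_sub, CTerm.eval, hY]
  · simp only [alternativeTerm, alternativeElement, Sum.elim_inr,
      CTerm.eval_sub, CTerm.eval, hX]

/-- A connective which is positive if the last entries are greater than `1/2`. -/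
def separation {K m : ℕ} (r : Fin 6 ⊕ Fin K ⊕ (Fin m × Fin m) → ℝ) : ℝ :=
  ∏ ij ∈ Finset.univ.offDiag, max (r (.inr (.inr ij)) - 1 / 2) 0

/-- A connective which measures the failure of the alternative. -/
def alternativeDefect {K m : ℕ} (r : Fin 6 ⊕ Fin K ⊕ (Fin m × Fin m) → ℝ) : ℝ :=
  max (r (.inl 0) - 2 * r (.inl 1)) 0 +
    min (r (.inl 2) + max (1 - r (.inl 3)) 0 + max (1 - r (.inl 4)) 0)
      (∑ i, r (.inr (.inl i)) + max (r (.inl 5) - 1) 0)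

/-- For n < K the separation factor vanishes, so any y will do; for n ≥ K the defect itself
vanishes. -/
theorem exists_matrix_alternative {n K m : ℕ}
    (hm : n < K → ∀ z : Fin m → Matrix (Fin n) (Fin n) ℂ, (∀ i, ‖z i‖ ≤ 1) →
      ∃ i j, i ≠ j ∧ ‖z i - z j‖ ≤ 1 / 2)
    (x : Unit ⊕ Fin m → Matrix (Fin n) (Fin n) ℂ) (hx : ∀ i, ‖x i‖ ≤ 1) :
    ∃ y : Bool ⊕ Fin K → Matrix (Fin n) (Fin n) ℂ, (∀ j, ‖y j‖ ≤ 1) ∧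
      separation (fun j => ‖alternativeElement x y j‖) *
        alternativeDefect (fun j => ‖alternativeElement x y j‖) = 0 := by
  by_cases hnK : n < K
  · obtain ⟨i, j, hij, hclose⟩ := hm hnK (fun i => x (.inr i)) fun i => hx _
    refine ⟨0, by simp, mul_eq_zero_of_left (Finset.prod_eq_zero (i := (i, j))
      (by simpa using hij) ?_) _⟩
    simp only [alternativeElement, Sum.elim_inr]
    exact max_eq_right (by linarith)
  · obtain ⟨p, hp, hph⟩ := exists_matrix_projection_near
      (IsSelfAdjoint.star_mul_self (x (.inl ())))
    rcases exists_subprojection_or_copies (not_lt.1 hnK) hp with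
      ⟨q, hq, hqp, hq1, hpq1⟩ | ⟨v, hv, hvp, hvs⟩
    · have hqq : star q * q = q := by rw [hq.isSelfAdjoint.star_eq, hq.isIdempotentElem.eq]
      refine ⟨Sum.elim (fun j => if j then p else q) 0, ?_, mul_eq_zero_of_right _ ?_⟩
      · rintro ((_ | _) | _) <;> simp [hp.norm_le, hq1]
      simp only [alternativeDefect, alternativeElement, Sum.elim_inl, Sum.elim_inr,
        Matrix.cons_val, Bool.false_eq_true, if_true, if_false, hqp, hqq,
        hq.isIdempotentElem.eq, sub_self, norm_zero, hq1, hpq1, max_self, add_zero]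
      rw [max_eq_right (sub_nonpos.2 hph), zero_add]
      exact min_eq_left (add_nonneg (Finset.sum_nonneg fun _ _ => norm_nonneg _)
        (le_max_right _ _))
    · refine ⟨Sum.elim (fun j => if j then p else 0) v, ?_, mul_eq_zero_of_right _ ?_⟩
      · rintro ((_ | _) | _) <;> simp [hp.norm_le, hv]
      simp [alternativeDefect, alternativeElement, hvp]
      rw [max_eq_right (sub_nonpos.2 hph), max_eq_right (sub_nonpos.2 hvs), zero_add]
      exact min_eq_right (add_nonneg zero_le_one (le_max_right _ _))

/-- With 2/3-separated points in A every factor of `separation` is at least 2/3 - 1/2 = 1/6, so a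
small product forces a small defect. Since p₀ is an exact projection, the first term of the defect
makes p close to p₀. -/
theorem IsPseudomatricial.dichotomy (hA : IsPseudomatricial A) (hinf : ¬ FiniteDimensional ℂ A)
    {p₀ : A} (hp₀ : IsStarProjection p₀) (K : ℕ) {δ : ℝ} (hδ : 0 < δ) :
    ∃ (p y : A) (v : Fin K → A), ‖p‖ ≤ 1 ∧ ‖y‖ ≤ 1 ∧ ‖p - p₀‖ < δ ∧
      ((‖star (y * p) * (y * p) * (star (y * p) * (y * p)) - star (y * p) * (y * p)‖ < δ ∧
        1 - δ < ‖star (y * p) * (y * p)‖ ∧ 1 - δ < ‖p - star (y * p) * (y * p)‖) ∨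
      ((∀ i, ‖star (v i) * v i - p‖ < δ) ∧ ‖∑ i, v i * star (v i)‖ < 1 + δ)) := by
  obtain ⟨m, hm⟩ := exists_close_pair_matrix K
  obtain ⟨z, hz, hsep⟩ := exists_separated_of_not_finiteDimensional hinf m
  let O : Finset (Fin m × Fin m) := Finset.univ.offDiag
  have hc : (0 : ℝ) < (1 / 6) ^ O.card := by positivity
  obtain ⟨_, -, h⟩ := hA.transfer (γ := Empty) (ι := Unit ⊕ Fin m) (κ := Bool ⊕ Fin K)
    (fun _ X Y => alternativeTerm X Y)
    (fun r => separation r * alternativeDefect r)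
    (by unfold separation alternativeDefect; fun_prop)
    (by
      intro n hn
      refine ⟨fun k => k.elim, fun k => k.elim, fun x hx => ?_⟩
      obtain ⟨y, hy, h⟩ := exists_matrix_alternative (hm n) x hx
      refine ⟨y, hy, fun N Z X Y w hZ hX hY => ?_⟩
      simp only [eval_alternativeTerm hX hY]
      exact h.le)
    ((1 / 6) ^ O.card * δ) (by positivity)
  obtain ⟨y, hy, N, Z, X, Y, w, -, hX, hY, h⟩ := h (Sum.elim (fun _ => p₀) z) (by
    rintro (_ | _) <;> simp [hp₀.norm_le, hz])
  simp only [eval_alternativeTerm hX hY] at h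
  refine ⟨y (.inl true), y (.inl false), fun i => y (.inr i), hy _, hy _, ?_⟩
  have hpp : star p₀ * p₀ = p₀ := by rw [hp₀.isSelfAdjoint.star_eq, hp₀.isIdempotentElem.eq]
  set x : Unit ⊕ Fin m → A := Sum.elim (fun _ => p₀) z
  obtain ⟨r, hr⟩ : ∃ r, r = fun j => ‖alternativeElement x y j‖ := ⟨_, rfl⟩
  rw [← hr] at h
  have hr0 : ∀ j, 0 ≤ r j := fun j => by rw [hr]; exact norm_nonneg _
  have r0 : r (.inl 0) = ‖y (.inl true) - p₀‖ := by
    simp [hr, alternativeElement, x, hpp]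
  have r1 : r (.inl 1) = 0 := by
    simp [hr, alternativeElement, x, hpp, hp₀.isIdempotentElem.eq]
  have r2 : r (.inl 2) =
      ‖star (y (.inl false) * y (.inl true)) * (y (.inl false) * y (.inl true)) *
        (star (y (.inl false) * y (.inl true)) * (y (.inl false) * y (.inl true))) -
        star (y (.inl false) * y (.inl true)) * (y (.inl false) * y (.inl true))‖ := by rw [hr]; rfl
  have r3 : r (.inl 3) =
      ‖star (y (.inl false) * y (.inl true)) * (y (.inl false) * y (.inl true))‖ := by rw [hr]; rfl
  have r4 : r (.inl 4) = ‖y (.inl true) -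
      star (y (.inl false) * y (.inl true)) * (y (.inl false) * y (.inl true))‖ := by rw [hr]; rfl
  have r5 : r (.inl 5) = ‖∑ i, y (.inr i) * star (y (.inr i))‖ := by rw [hr]; rfl
  have r6 : ∀ i, r (.inr (.inl i)) = ‖star (y (.inr i)) * y (.inr i) - y (.inl true)‖ :=
    fun i => by rw [hr]; rfl
  have r7 : ∀ ij, r (.inr (.inr ij)) = ‖z ij.1 - z ij.2‖ := fun ij => by rw [hr]; rfl
  have hD : (1 / 6) ^ O.card ≤ separation r := by
    rw [← Finset.prod_const, separation]
    refine Finset.prod_le_prod (fun _ _ => by norm_num) fun ij hij => le_max_of_le_left ?_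
    have h1 := hsep ij.1 ij.2 (by simpa [O] using hij)
    rw [r7]
    linarith
  have hF0 : 0 ≤ alternativeDefect r := by
    unfold alternativeDefect
    have := Finset.sum_nonneg fun i (_ : i ∈ Finset.univ) => hr0 (.inr (.inl i))
    have := hr0 (.inl 2)
    positivity
  have hF : alternativeDefect r < δ := by
    by_contra! hcon
    exact absurd (mul_le_mul hD hcon hδ.le (hc.le.trans hD)) h.not_ge
  unfold alternativeDefect at hF
  have hS0 := Finset.sum_nonneg fun i (_ : i ∈ Finset.univ) => hr0 (.inr (.inl i))
  have hr2 := hr0 (.inl 2)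
  have hmin : min (r (.inl 2) + max (1 - r (.inl 3)) 0 + max (1 - r (.inl 4)) 0)
      (∑ i, r (.inr (.inl i)) + max (r (.inl 5) - 1) 0) < δ := by
    linarith [le_max_right (r (.inl 0) - 2 * r (.inl 1)) 0]
  have hmin0 : 0 ≤ min (r (.inl 2) + max (1 - r (.inl 3)) 0 + max (1 - r (.inl 4)) 0)
      (∑ i, r (.inr (.inl i)) + max (r (.inl 5) - 1) 0) := by positivity
  rw [← r0, ← r2, ← r3, ← r4, ← r5]
  simp only [← r6]
  refine ⟨by linarith [le_max_left (r (.inl 0) - 2 * r (.inl 1)) 0], ?_⟩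
  have h3 := le_max_right (1 - r (.inl 3)) 0
  have h3' := le_max_left (1 - r (.inl 3)) 0
  have h4 := le_max_right (1 - r (.inl 4)) 0
  have h4' := le_max_left (1 - r (.inl 4)) 0
  have h5 := le_max_right (r (.inl 5) - 1) 0
  have h5' := le_max_left (r (.inl 5) - 1) 0
  rcases min_lt_iff.1 hmin with h6 | h6
  · exact .inl ⟨by linarith, by linarith, by linarith⟩
  · refine .inr ⟨fun i => ?_, by linarith⟩
    have := Finset.single_le_sum (fun i _ => hr0 (.inr (.inl i))) (Finset.mem_univ i)
    linarith

/-- A minimal projection is approximately equivalent to arbitrarily many orthogonal projections. -/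
theorem IsPseudomatricial.exists_copies (hA : IsPseudomatricial A)
    (hinf : ¬ FiniteDimensional ℂ A) {p₀ : A} (hp₀ : IsMinimalProjection p₀) (K : ℕ) {ε : ℝ}
    (hε : 0 < ε) :
    ∃ v : Fin K → A, (∀ i, ‖star (v i) * v i - p₀‖ ≤ ε) ∧ ‖∑ i, v i * star (v i)‖ ≤ 1 + ε := by
  have hp := hp₀.isStarProjection
  set δ := min (ε / 2) (1 / 200) with hδ
  have hδ0 : 0 < δ := by positivity
  have hδ1 : δ ≤ ε / 2 := min_le_left _ _
  have hδ2 : δ ≤ 1 / 200 := min_le_right _ _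
  obtain ⟨p, y, v, hp1, hy1, hpp, (⟨h1, h2, h3⟩ | ⟨h1, h2⟩)⟩ := hA.dichotomy hinf hp K hδ0
  -- H lies under the perturbed p, so it is replaced by G, which satisfies G p₀ = G. A projection
  -- near G is then 0 or p₀ by minimality, but H is far from both; 18 δ < 1 suffices.
  · exfalso
    set H := star (y * p) * (y * p)
    set G := star (y * p₀) * (y * p₀)
    have hyp : ‖y * p‖ ≤ 1 := (norm_mul_le _ _).trans (mul_le_one₀ hy1 (norm_nonneg _) hp1)
    have hyp₀ : ‖y * p₀‖ ≤ 1 :=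
      (norm_mul_le _ _).trans (mul_le_one₀ hy1 (norm_nonneg _) hp.norm_le)
    have hsub : ‖y * p - y * p₀‖ ≤ δ := by
      rw [← mul_sub]
      exact (norm_mul_le _ _).trans ((mul_le_of_le_one_left (norm_nonneg _) hy1).trans hpp.le)
    have norm_mul_sub_mul : ∀ a b c d : A, ‖a‖ ≤ 1 → ‖d‖ ≤ 1 →
        ‖a * b - c * d‖ ≤ ‖b - d‖ + ‖a - c‖ := by
      intro a b c d ha hd
      rw [show a * b - c * d = a * (b - d) + (a - c) * d by
        rw [mul_sub, sub_mul]; abel]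
      refine (norm_add_le _ _).trans (add_le_add ?_ ?_)
      · exact (norm_mul_le _ _).trans (mul_le_of_le_one_left (norm_nonneg _) ha)
      · exact (norm_mul_le _ _).trans (mul_le_of_le_one_right (norm_nonneg _) hd)
    have hH1 : ‖H‖ ≤ 1 := by
      rw [CStarRing.norm_star_mul_self]
      exact mul_le_one₀ hyp (norm_nonneg _) hyp
    have hG1 : ‖G‖ ≤ 1 := by
      rw [CStarRing.norm_star_mul_self]
      exact mul_le_one₀ hyp₀ (norm_nonneg _) hyp₀
    have hHG : ‖H - G‖ ≤ 2 * δ := by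
      refine (norm_mul_sub_mul _ _ _ _ (by rwa [norm_star]) hyp₀).trans ?_
      rw [← star_sub, norm_star]
      linarith
    have hHG2 : ‖H * H - G * G‖ ≤ 4 * δ := by
      linarith [norm_mul_sub_mul H H G G hH1 hG1]
    have hG : ‖G * G - G‖ ≤ 7 * δ := by
      rw [show G * G - G = (H * H - H) - (H * H - G * G) + (H - G) by abel]
      linarith [norm_add_le ((H * H - H) - (H * H - G * G)) (H - G),
        norm_sub_le (H * H - H) (H * H - G * G)]
    obtain ⟨q, b, hq, hqG, hqb⟩ := exists_projection_near (IsSelfAdjoint.star_mul_self (y * p₀))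
      (hG.trans_lt (by linarith))
    have hGp : G * p₀ = G := by
      simp only [G, mul_assoc, hp.isIdempotentElem.eq]
    have hqH : ‖q - H‖ ≤ 16 * δ := by
      linarith [norm_sub_le_norm_sub_add_norm_sub q G H, norm_sub_rev H G]
    rcases hp₀.eq_zero_or_eq q hq (by rw [hqb, mul_assoc, hGp]) with h0 | h0
    · rw [h0, zero_sub, norm_neg] at hqH
      linarith
    · rw [h0] at hqH
      linarith [norm_sub_le_norm_sub_add_norm_sub p p₀ H]
  · refine ⟨v, fun i => ?_, by linarith⟩
    linarith [norm_sub_le_norm_sub_add_norm_sub (star (v i) * v i) p p₀, h1 i]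

/-- A tracial state vanishes at the minimal projections. -/
theorem IsPseudomatricial.apply_isMinimalProjection_eq_zero (hA : IsPseudomatricial A)
    (hinf : ¬ FiniteDimensional ℂ A) {p : A} (hp : IsMinimalProjection p) {τ : A →L[ℂ] ℂ}
    (hτ : IsTracialState τ) : τ p = 0 := by
  -- With error 1/(K+1) for each copy, the K errors add up to at most 1, and the sum of the v v* has
  -- norm at most 2.
  have key : ∀ K : ℕ, K * ‖τ p‖ ≤ 3 := by
    intro K
    have hK : (0 : ℝ) < 1 / (K + 1) := by positivity
    have hK1 : K * (1 / ((K : ℝ) + 1)) ≤ 1 := by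
      rw [mul_one_div, div_le_one (by positivity)]
      linarith
    have hK2 : 1 / ((K : ℝ) + 1) ≤ 1 := by
      rw [div_le_one (by positivity)]
      linarith [(Nat.cast_nonneg K : (0 : ℝ) ≤ K)]
    obtain ⟨v, hv, hs⟩ := hA.exists_copies hinf hp K hK
    have hle : ∀ a : A, ‖τ a‖ ≤ ‖a‖ := fun a => by
      simpa [hτ.norm_eq_one] using τ.le_opNorm a
    have h1 : (K : ℂ) * τ p = τ (∑ i, v i * star (v i)) -
        ∑ i, τ (star (v i) * v i - p) := by
      simp [map_sum, hτ.mul_comm (v _) (star (v _))]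
    have h2 : ‖∑ i, τ (star (v i) * v i - p)‖ ≤ K * (1 / ((K : ℝ) + 1)) := by
      refine (norm_sum_le _ _).trans
        ((Finset.sum_le_sum fun i _ => (hle _).trans (hv i)).trans (le_of_eq ?_))
      simp
    have h3 : (K : ℝ) * ‖τ p‖ = ‖(K : ℂ) * τ p‖ := by simp
    rw [h3, h1]
    refine (norm_sub_le _ _).trans ?_
    linarith [hle (∑ i, v i * star (v i))]
  by_contra h0
  obtain ⟨K, hK⟩ := exists_nat_gt (3 / ‖τ p‖)
  rw [div_lt_iff₀ (norm_pos_iff.2 h0)] at hK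
  exact (key K).not_gt hK

end Copies

/-! ### The null ideal of a trace -/

section Simplicity

variable {A : Type u} [NonUnitalCStarAlgebra A]

theorem eq_zero_of_forall_nonneg_add_mul {c z : ℂ}
    (h : ∀ t : ℝ, 0 ≤ (c + t * z).re ∧ (c + t * z).im = 0) : z = 0 := by
  have him : z.im = 0 := by
    have h0 := (h 0).2
    have h1 := (h 1).2
    simp at h0 h1
    linarith
  have hre : z.re = 0 := by
    by_contra h0
    have h1 := (h (-(c.re + 1) / z.re)).1
    simp only [Complex.add_re, Complex.mul_re, Complex.ofReal_re, Complex.ofReal_im, zero_mul,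
      sub_zero, div_mul_cancel₀ _ h0] at h1
    linarith
  exact Complex.ext hre him

/-- A null vector of a positive functional is orthogonal to all elements. -/
theorem IsTracialState.apply_star_mul_eq_zero {τ : A →L[ℂ] ℂ} (hτ : IsTracialState τ) {a : A}
    (ha : τ (star a * a) = 0) (x : A) : τ (star x * a) = 0 := by
  -- Positivity at x + t c a for all real t, where the quadratic term vanishes, kills the linear
  -- term; c = 1 and c = i then separate its two summands.
  have key : ∀ c : ℂ, c * τ (star x * a) + star c * τ (star a * x) = 0 := by
    intro c
    refine eq_zero_of_forall_nonneg_add_mul (c := τ (star x * x)) fun t => ?_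
    have h := hτ.nonneg (x + ((t : ℂ) * c) • a)
    have h1 : τ (star (x + ((t : ℂ) * c) • a) * (x + ((t : ℂ) * c) • a)) =
        τ (star x * x) + t * (c * τ (star x * a) + star c * τ (star a * x)) := by
      simp only [star_add, star_smul, add_mul, mul_add, smul_mul_assoc, mul_smul_comm, map_add,
        map_smul, ha, smul_eq_mul, star_mul', Complex.star_def, Complex.conj_ofReal]
      ring
    rw [h1, Complex.nonneg_iff] at h
    exact ⟨h.1, h.2.symm⟩
  have h1 := key 1
  have h2 := key Complex.I
  simp only [star_one, one_mul, Complex.star_def, Complex.conj_I] at h1 h2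
  have h3 : 2 * Complex.I * τ (star x * a) = 0 := by linear_combination Complex.I * h1 + h2
  simpa using h3

/-- The null space of a functional under the pairing `(x, a) ↦ τ(x a)`. -/
def nullIdeal (τ : A →L[ℂ] ℂ) : Submodule ℂ A where
  carrier := {a | ∀ x, τ (x * a) = 0}
  zero_mem' x := by simp
  add_mem' ha hb x := by simp [mul_add, ha x, hb x]
  smul_mem' c a ha x := by rw [mul_smul_comm, map_smul, ha x, smul_zero]

theorem isClosedIdeal_nullIdeal {τ : A →L[ℂ] ℂ} (hτ : IsTracialState τ) :
    IsClosedIdeal (nullIdeal τ) := by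
  refine ⟨?_, fun a x hx y => ?_, fun a x hx y => ?_⟩
  · have : (nullIdeal τ : Set A) = ⋂ x, {a | τ (x * a) = 0} := by
      ext a
      simp [nullIdeal]
    rw [this]
    exact isClosed_iInter fun x => isClosed_eq (by fun_prop) continuous_const
  · rw [← mul_assoc]
    exact hx _
  · rw [← mul_assoc, hτ.mul_comm, ← mul_assoc]
    exact hx _

theorem not_isSimple_of_not_isFaithful {e : A} (he : ∀ x : A, e * x = x) {τ : A →L[ℂ] ℂ}
    (hτ : IsTracialState τ) (hf : ¬ IsFaithful τ) : ¬ IsSimple A := by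
  intro hs
  simp only [IsFaithful, not_forall] at hf
  obtain ⟨a, ha, ha0⟩ := hf
  have hmem : a ∈ nullIdeal τ := fun x => by
    simpa using hτ.apply_star_mul_eq_zero ha (star x)
  rcases hs.eq_bot_or_eq_top _ (isClosedIdeal_nullIdeal hτ) with h | h
  · rw [h] at hmem
    exact ha0 hmem
  · have h0 : τ = 0 := by
      ext x
      have hx : x ∈ nullIdeal τ := h ▸ Submodule.mem_top
      simpa [he] using hx e
    have := hτ.norm_eq_one
    simp [h0] at this

end Simplicity

end CStarLogic

end

theorem corollary6p4 {A : Type*} [NonUnitalCStarAlgebra A]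
    (hA : CStarLogic.IsPseudomatricial A) (hinf : ¬ FiniteDimensional ℂ A) :
    (∀ p : A, CStarLogic.IsMinimalProjection p →
      ∀ τ : A →L[ℂ] ℂ, CStarLogic.IsTracialState τ → τ p = 0) ∧
    (∃ τ : A →L[ℂ] ℂ, CStarLogic.IsTracialState τ ∧ ¬ CStarLogic.IsFaithful τ) ∧
    ¬ CStarLogic.IsSimple A := by
  have h1 : ∀ p : A, CStarLogic.IsMinimalProjection p →
      ∀ τ : A →L[ℂ] ℂ, CStarLogic.IsTracialState τ → τ p = 0 :=
    fun p hp τ hτ => hA.apply_isMinimalProjection_eq_zero hinf hp hτ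
  obtain ⟨τ, hτ⟩ := hA.exists_isTracialState
  obtain ⟨p, hp⟩ := hA.exists_isMinimalProjection
  have hf : ¬ CStarLogic.IsFaithful τ := fun hf => hp.ne_zero (hf p (by
    rw [hp.isStarProjection.isSelfAdjoint.star_eq, hp.isStarProjection.isIdempotentElem.eq]
    exact h1 p hp τ hτ))
  obtain ⟨e, he, -, -⟩ := hA.exists_unit
  exact ⟨h1, ⟨τ, hτ, hf⟩, CStarLogic.not_isSimple_of_not_isFaithful he hτ hf⟩
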